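/- Let $\{V(i): i\ge 1\}$ be a (weakly) stationary real-valued process on a probability space $(\Omega,\mathcal A,P)$ with absolutely summable auto-covariance function $\gamma(h)=\operatorname{cov}(V(1),V(1+|h|))$, $h\in\mathbb Z$, and spectral density $f(\lambda)=\frac1{2\pi}\sum_{n\in\mathbb Z}e^{-in\lambda}\gamma(n)$. For each sample size $T\ge 1$ put $N=\lfloor (T-1)/2\rfloor$ and $\lambda_k=2\pi k/T$, and let $x^*(1),\dots,x^*(N),y^*(1),\dots,y^*(N)$ (depending on $T$) be real random variables on $\Omega$, the bootstrap Fourier coefficients. Let $\mathcal L^*$, $E^*$, $\operatorname{var}^*$ denote law, expectation and variance under the (regular) conditional distribution given the data $V(1),\dots,V(T)$. Put $x^*(T)=y^*(T)=0$, for even $T$ also $x^*(T/2)=y^*(T/2)=0$, and $x^*(T-j)=x^*(j)$, $y^*(T-j)=-y^*(j)$ for $1\le j\le N$, and let $$Z^*(t)=\frac1{\sqrt T}\sum_{j=1}^{T}\bigl(x^*(j)+iy^*(j)\bigr)e^{2\pi i tj/T}=\frac{2}{\sqrt T}\sum_{k=1}^{N}\bigl(x^*(k)\cos(\lambda_k t)-y^*(k)\sin(\lambda_k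 t)\bigr).$$ Assume that 1. for every $T$, conditionally on the data (almost surely), the $2N$ variables $x^*(1),\dots,x^*(N),y^*(1),\dots,y^*(N)$ are independent, with $E^*x^*(k)=E^*y^*(k)=0$ for all $k$; 2. $\sup_{1\le k\le N}|\operatorname{var}^*(x^*(k))-\pi f(\lambda_k)|=o_P(1)$ and $\sup_{1\le k\le N}|\operatorname{var}^*(y^*(k))-\pi f(\lambda_k)|=o_P(1)$ as $T\to\infty$; 3. for some constant $C$, $\sup_{1\le k\le N}E^*(x^*(k))^4\le C+o_P(1)$ and $\sup_{1\le k\le N}E^*(y^*(k))^4\le C+o_P(1)$ as $T\to\infty$. Then for all fixed positive integers $l_1,\dots,l_p$, as $T\to\infty$, $$\mathcal L^*\bigl(Z^*(l_1),\dots,Z^*(l_p)\bigr)\longrightarrow N(0,\Sigma)\quad\text{weakly, in } P\text{-probability},\qquad \Sigma=\bigl(\operatorname{cov}(V(l_i),V(l_j))\bigr)_{i,j=1}^{p},$$ that is, for every bounded continuous $g:\mathbb R^p\to\mathbb R$, $E^*g(Z^*(l_1),\dots,Z^*(l_p))\to\int g\,dN(0,\Sigma)$ in $P$-probability. -/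

import Mathlib

open MeasureTheory ProbabilityTheory Filter Topology
open scoped ENNReal NNReal BoundedContinuousFunction

namespace TFT

noncomputable section

/-! ### The observed process -/

/-- A real process `V 1, V 2, …` (the value `V 0` plays no role) is (weakly) stationary: finite
second moments, constant mean, and covariances depending on the time lag only. -/
structure IsStationary {Ω : Type*} [MeasurableSpace Ω] (P : Measure Ω) (V : ℕ → Ω → ℝ) :
    Prop where
  memLp : ∀ i, 1 ≤ i → MemLp (V i) 2 P
  mean : ∀ i, 1 ≤ i → ∫ ω, V i ω ∂P = ∫ ω, V 1 ω ∂P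
  cov : ∀ i, 1 ≤ i → ∀ h : ℕ, cov[V i, V (i + h); P] = cov[V 1, V (1 + h); P]

/-- The auto-covariance function `γ(h) = cov(V(1), V(1 + |h|))`, `h ∈ ℤ`. -/
def autocov {Ω : Type*} [MeasurableSpace Ω] (P : Measure Ω) (V : ℕ → Ω → ℝ) (h : ℤ) : ℝ :=
  cov[V 1, V (1 + h.natAbs); P]

/-- The spectral density `f(lam) = (2π)⁻¹ ∑_{n ∈ ℤ} exp(-i n lam) γ(n)`.  The sum is real because
`γ` is even. -/
def spectralDensity {Ω : Type*} [MeasurableSpace Ω] (P : Measure Ω) (V : ℕ → Ω → ℝ)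
    (lam : ℝ) : ℝ :=
  (2 * Real.pi)⁻¹ *
    (∑' n : ℤ, Complex.exp (-Complex.I * (n : ℂ) * (lam : ℂ)) * (autocov P V n : ℂ)).re

/-- Assumption on the process: stationary with absolutely summable auto-covariance function. -/
structure AssumptionP1 {Ω : Type*} [MeasurableSpace Ω] (P : Measure Ω) (V : ℕ → Ω → ℝ) :
    Prop where
  stationary : IsStationary P V
  summable : Summable fun h : ℤ => |autocov P V h|

/-- The observed stretch `(V 1, …, V T)`. -/
def observed {Ω : Type*} (V : ℕ → Ω → ℝ) (T : ℕ) (ω : Ω) : Fin T → ℝ :=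
  fun i => V (i + 1) ω

/-- The conditional law of `Y` given the data `V 1, …, V T`, as a random probability measure. -/
def condLaw {Ω S : Type*} [MeasurableSpace Ω] [MeasurableSpace S] [StandardBorelSpace S]
    [Nonempty S] (P : Measure Ω) [IsFiniteMeasure P] (V : ℕ → Ω → ℝ) (T : ℕ) (Y : Ω → S)
    (ω : Ω) : Measure S :=
  condDistrib Y (observed V T) P (observed V T ω)

/-! ### The bootstrap sample -/

/-- `N = ⌊(T - 1) / 2⌋`. -/
def numFreq (T : ℕ) : ℕ := (T - 1) / 2

/-- The Fourier frequency `2πj/T`. -/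
def freq (T j : ℕ) : ℝ := 2 * Real.pi * j / T

/-- The vector of resampled Fourier coefficients `x*(1), …, x*(N)` (left summand) and
`y*(1), …, y*(N)` (right summand) for sample size `T`. -/
def bootCoef {Ω : Type*} (xs ys : ℕ → ℕ → Ω → ℝ) (T : ℕ) (ω : Ω) :
    Fin (numFreq T) ⊕ Fin (numFreq T) → ℝ :=
  Sum.elim (fun k => xs T (k + 1) ω) (fun k => ys T (k + 1) ω)

/-- All bootstrap Fourier coefficients `x*(j) + i y*(j)`, `1 ≤ j ≤ T`: zero at `j = T` and, for
even `T`, at `j = T/2`; extended from `j ≤ N` by `x*(T-j) = x*(j)`, `y*(T-j) = -y*(j)`. -/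
def fullCoef {Ω : Type*} (xs ys : ℕ → ℕ → Ω → ℝ) (T j : ℕ) (ω : Ω) : ℂ :=
  if j = T ∨ 2 * j = T then 0
  else if j ≤ numFreq T then (xs T j ω : ℂ) + Complex.I * (ys T j ω : ℂ)
  else (xs T (T - j) ω : ℂ) - Complex.I * (ys T (T - j) ω : ℂ)

/-- The inverse discrete Fourier transform of the bootstrap coefficients,
`T^{-1/2} ∑_{j=1}^T (x*(j) + i y*(j)) exp(2πi t j / T)`. -/
def inverseFFT {Ω : Type*} (xs ys : ℕ → ℕ → Ω → ℝ) (T t : ℕ) (ω : Ω) : ℂ :=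
  ((Real.sqrt T)⁻¹ : ℂ) * ∑ j ∈ Finset.Icc 1 T,
    fullCoef xs ys T j ω * Complex.exp (2 * Real.pi * Complex.I * t * j / T)

/-- The bootstrap observation `Z*(t)` for sample size `T`; the inverse transform is real, see
`inverseFFT_eq`. -/
def zStar {Ω : Type*} (xs ys : ℕ → ℕ → Ω → ℝ) (T t : ℕ) (ω : Ω) : ℝ :=
  (inverseFFT xs ys T t ω).re

/-- The inverse transform is real-valued and has the usual explicit form. -/
theorem inverseFFT_eq {Ω : Type*} (xs ys : ℕ → ℕ → Ω → ℝ) (T t : ℕ) (ω : Ω) :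
    inverseFFT xs ys T t ω =
      ((2 / Real.sqrt T * ∑ k ∈ Finset.Icc 1 (numFreq T),
        (xs T k ω * Real.cos (freq T k * t) - ys T k ω * Real.sin (freq T k * t)) : ℝ) : ℂ) := by
  have hterm : ∀ k ∈ Finset.Icc 1 (numFreq T),
      fullCoef xs ys T k ω * Complex.exp (2 * Real.pi * Complex.I * t * k / T) +
        fullCoef xs ys T (T - k) ω *
          Complex.exp (2 * Real.pi * Complex.I * t * (T - k : ℕ) / T) =
      ((2 * (xs T k ω * Real.cos (freq T k * t) - ys T k ω * Real.sin (freq T k * t)) : ℝ) :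
        ℂ) := by
    intro k hk
    rw [Finset.mem_Icc] at hk
    unfold numFreq at hk
    have hT : (T : ℂ) ≠ 0 := by
      have : T ≠ 0 := by omega
      exact_mod_cast this
    have e1 : Complex.exp (2 * Real.pi * Complex.I * t * k / T) =
        Complex.exp (((freq T k * t : ℝ) : ℂ) * Complex.I) := by
      congr 1
      unfold freq
      push_cast
      ring
    have e2 : Complex.exp (2 * Real.pi * Complex.I * t * (T - k : ℕ) / T) =
        Complex.exp (((-(freq T k * t) : ℝ) : ℂ) * Complex.I) := by
      rw [Complex.exp_eq_exp_iff_exists_int]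
      refine ⟨t, ?_⟩
      rw [Nat.cast_sub (by omega)]
      unfold freq
      push_cast
      field_simp
      ring
    have c1 : fullCoef xs ys T k ω = (xs T k ω : ℂ) + Complex.I * (ys T k ω : ℂ) := by
      unfold fullCoef numFreq
      rw [if_neg (by omega), if_pos (by omega)]
    have c2 : fullCoef xs ys T (T - k) ω = (xs T k ω : ℂ) - Complex.I * (ys T k ω : ℂ) := by
      unfold fullCoef numFreq
      rw [if_neg (by omega), if_neg (by omega), show T - (T - k) = k by omega]
    rw [e1, e2, c1, c2, Complex.exp_ofReal_mul_I, Complex.exp_ofReal_mul_I, Real.cos_neg,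
      Real.sin_neg]
    push_cast
    linear_combination (2 * (ys T k ω : ℂ) * Complex.sin ((freq T k : ℂ) * t)) * Complex.I_sq
  have hsplit : ∀ g : ℕ → ℂ, (∀ j, j = T ∨ 2 * j = T → g j = 0) →
      ∑ j ∈ Finset.Icc 1 T, g j = ∑ k ∈ Finset.Icc 1 (numFreq T), (g k + g (T - k)) := by
    intro g hg
    have hinj : Set.InjOn (fun k => T - k) (Finset.Icc 1 (numFreq T) : Set ℕ) := by
      intro a ha b hb hab
      simp only [Finset.coe_Icc, Set.mem_Icc, numFreq] at ha hb hab
      omega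
    rw [Finset.sum_add_distrib, ← Finset.sum_image (f := g) hinj, ← Finset.sum_union]
    · symm
      apply Finset.sum_subset
      · intro j hj
        simp only [Finset.mem_union, Finset.mem_Icc, Finset.mem_image, numFreq] at hj ⊢
        rcases hj with hj | ⟨a, ha, hab⟩
        · omega
        · omega
      · intro j hj hj'
        apply hg
        simp only [Finset.mem_union, Finset.mem_Icc, Finset.mem_image, numFreq, not_or,
          not_exists, not_and] at hj hj'
        have := hj'.2 (T - j)
        omega
    · rw [Finset.disjoint_left]
      intro j hj hj'
      simp only [Finset.mem_Icc, Finset.mem_image, numFreq] at hj hj'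
      obtain ⟨a, ha, hab⟩ := hj'
      omega
  unfold inverseFFT
  rw [hsplit _ (fun j hj => by simp [fullCoef, hj]), Finset.sum_congr rfl hterm,
    ← Complex.ofReal_sum, ← Finset.mul_sum]
  push_cast
  ring

/-! ### The assumptions on the resampling scheme in the frequency domain -/

/-- For every sample size `T`, conditionally on the data, all the coefficients
`x*(1), …, x*(N), y*(1), …, y*(N)` are independent, with mean zero. -/
structure AssumptionB1 {Ω : Type*} [MeasurableSpace Ω] (P : Measure Ω) [IsFiniteMeasure P]
    (V : ℕ → Ω → ℝ) (xs ys : ℕ → ℕ → Ω → ℝ) : Prop where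
  indep : ∀ T, ∀ᵐ ω ∂P,
    iIndepFun (fun s (c : Fin (numFreq T) ⊕ Fin (numFreq T) → ℝ) => c s)
      (condLaw P V T (bootCoef xs ys T) ω)
  centered : ∀ T, ∀ᵐ ω ∂P, ∀ s : Fin (numFreq T) ⊕ Fin (numFreq T),
    Integrable (fun c => c s) (condLaw P V T (bootCoef xs ys T) ω) ∧
      ∫ c, c s ∂(condLaw P V T (bootCoef xs ys T) ω) = 0

/-- The random variable `X` under the law `ν` has a finite second moment and a variance that
differs from `v` by at most `ε`. -/
def VarWithin {S : Type*} [MeasurableSpace S] (ν : Measure S) (X : S → ℝ) (v ε : ℝ) : Prop :=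
  MemLp X 2 ν ∧ |Var[X; ν] - v| ≤ ε

/-- `sup_{1 ≤ k ≤ N} |var*(x*(k)) - π f(λ_k)| = o_P(1)` and the same for `y*`: for every `ε > 0`
the probability that the bound `ε` is violated for some `k` tends to zero. -/
structure AssumptionB2 {Ω : Type*} [MeasurableSpace Ω] (P : Measure Ω) [IsFiniteMeasure P]
    (V : ℕ → Ω → ℝ) (xs ys : ℕ → ℕ → Ω → ℝ) : Prop where
  var_x : ∀ ε : ℝ, 0 < ε → Tendsto (fun T => P {ω | ∃ k : Fin (numFreq T),
    ¬ VarWithin (condLaw P V T (bootCoef xs ys T) ω) (fun c => c (Sum.inl k))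
      (Real.pi * spectralDensity P V (freq T (k + 1))) ε}) atTop (𝓝 0)
  var_y : ∀ ε : ℝ, 0 < ε → Tendsto (fun T => P {ω | ∃ k : Fin (numFreq T),
    ¬ VarWithin (condLaw P V T (bootCoef xs ys T) ω) (fun c => c (Sum.inr k))
      (Real.pi * spectralDensity P V (freq T (k + 1))) ε}) atTop (𝓝 0)

/-- `sup_{1 ≤ k ≤ N} E*(x*(k))⁴ ≤ C + o_P(1)` for some constant `C`, and the same for `y*`
(fourth moments as elements of `[0, ∞]`). -/
structure AssumptionB3 {Ω : Type*} [MeasurableSpace Ω] (P : Measure Ω) [IsFiniteMeasure P]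
    (V : ℕ → Ω → ℝ) (xs ys : ℕ → ℕ → Ω → ℝ) : Prop where
  fourth_x : ∃ C : ℝ≥0, ∀ ε : ℝ≥0, 0 < ε → Tendsto (fun T => P {ω |
    (C + ε : ℝ≥0∞) < ⨆ k : Fin (numFreq T),
      ∫⁻ c, ENNReal.ofReal (c (Sum.inl k) ^ 4) ∂(condLaw P V T (bootCoef xs ys T) ω)})
    atTop (𝓝 0)
  fourth_y : ∃ C : ℝ≥0, ∀ ε : ℝ≥0, 0 < ε → Tendsto (fun T => P {ω |
    (C + ε : ℝ≥0∞) < ⨆ k : Fin (numFreq T),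
      ∫⁻ c, ENNReal.ofReal (c (Sum.inr k) ^ 4) ∂(condLaw P V T (bootCoef xs ys T) ω)})
    atTop (𝓝 0)

/-! ### Conditional weak convergence in probability -/

/-- The random measures `ν T` converge weakly to `μ`, in `P`-probability: the integral of every
bounded continuous function converges in probability. -/
def TendstoWeaklyInProb {Ω S : Type*} [MeasurableSpace Ω] [MeasurableSpace S]
    [TopologicalSpace S] (P : Measure Ω) (ν : ℕ → Ω → Measure S) (μ : Measure S) : Prop :=
  ∀ g : S →ᵇ ℝ,
    TendstoInMeasure P (fun T ω => ∫ z, g z ∂(ν T ω)) atTop (fun _ => ∫ z, g z ∂μ)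

/-- The bootstrap vector `(Z*(l 1), …, Z*(l p))`. -/
def bootVec {Ω : Type*} (xs ys : ℕ → ℕ → Ω → ℝ) {p : ℕ} (l : Fin p → ℕ) (T : ℕ) (ω : Ω) :
    EuclideanSpace ℝ (Fin p) :=
  WithLp.toLp 2 fun i => zStar xs ys T (l i) ω

end

end TFT

/-! Conditionally on the data, `Z*(l_1), …, Z*(l_p)` are linear combinations of 2N ≤ T independent
centred variables with weights of size O(T^{-1/2}). For a fixed direction u, a Lyapunov argument
applies: bounded fourth moments make each factor of the characteristic function agree with a
Gaussian factor up to O(T^{-3/2}), so the product is off by O(T^{-1/2})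
(`norm_integral_exp_sum_sub_gaussian_le`).

It remains to identify the variance. Replacing each conditional variance by π f(λ_k) costs O(δ) when
the errors are at most δ. The cosine and sine weights then combine into cos((l_i - l_j)λ_k), and a
Riemann-type sum of f against this cosine tends to γ(l_i - l_j). This follows by expanding f in its
cosine series and using asymptotic orthogonality of cosines at the Fourier frequencies
(`tendsto_mean_spectralDensity_mul_cos`). Lévy's continuity theorem gives the limit for
deterministic laws.

Randomness enters only at the end. The deterministic theorem holds along arbitrary sequences of
admissible laws, hence uniformly over all of them (`exists_isAdmissible_dist_integral_lt`), and the
conditional law is admissible outside an event whose probability tends to zero. -/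

namespace TFT

/-! ### Characteristic function estimates -/

/-- Second-order Taylor bound for `exp (i x)`. -/
lemma norm_exp_mul_I_sub_taylor_two_le (x : ℝ) :
    ‖Complex.exp (x * Complex.I) - (1 + x * Complex.I - (x : ℂ) ^ 2 / 2)‖ ≤ 4 * |x| ^ 3 := by
  rcases le_or_gt |x| 1 with hx | hx
  · have h := Complex.exp_bound (x := x * Complex.I) (by simpa using hx) (n := 3) (by norm_num)
    have e : ∑ m ∈ Finset.range 3, ((x : ℂ) * Complex.I) ^ m / (m.factorial : ℂ) =
        1 + x * Complex.I - (x : ℂ) ^ 2 / 2 := by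
      simp [Finset.sum_range_succ, mul_pow, Nat.factorial]
      ring
    rw [e] at h
    refine h.trans ?_
    have h3 : 0 ≤ |x| ^ 3 := by positivity
    simp only [norm_mul, Complex.norm_real, Complex.norm_I, mul_one, Real.norm_eq_abs]
    norm_num [Nat.factorial]
    linarith
  · have h1 : ‖Complex.exp (x * Complex.I)‖ = 1 := Complex.norm_exp_ofReal_mul_I x
    have h2 : ‖1 + x * Complex.I - (x : ℂ) ^ 2 / 2‖ ≤ 1 + |x| + |x| ^ 2 / 2 := by
      refine (norm_sub_le _ _).trans (add_le_add ((norm_add_le _ _).trans ?_) ?_)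
      · simp
      · simp
    -- For |x| > 1 no cancellation is needed: 1 + 1 + |x| + |x|²/2 is at most 3.5 |x|³.
    refine (norm_sub_le _ _).trans ?_
    rw [h1]
    have : |x| ≤ |x| ^ 2 := by nlinarith
    have : |x| ^ 2 ≤ |x| ^ 3 := by nlinarith [sq_nonneg |x|]
    linarith

/-- The difference of two products of numbers in the unit disc is at most the sum of the
differences. -/
lemma norm_prod_sub_prod_le_sum {ι : Type*} (s : Finset ι) (a b : ι → ℂ)
    (ha : ∀ i ∈ s, ‖a i‖ ≤ 1) (hb : ∀ i ∈ s, ‖b i‖ ≤ 1) :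
    ‖∏ i ∈ s, a i - ∏ i ∈ s, b i‖ ≤ ∑ i ∈ s, ‖a i - b i‖ := by
  classical
  induction s using Finset.induction_on with
  | empty => simp
  | insert i s hi ih =>
    rw [Finset.prod_insert hi, Finset.prod_insert hi, Finset.sum_insert hi]
    have ih' := ih (fun j hj => ha j (Finset.mem_insert_of_mem hj))
      (fun j hj => hb j (Finset.mem_insert_of_mem hj))
    have hB : ‖∏ j ∈ s, b j‖ ≤ 1 := by
      rw [norm_prod]
      exact Finset.prod_le_one (fun _ _ => norm_nonneg _)
        (fun j hj => hb j (Finset.mem_insert_of_mem hj))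
    have hA := ha i (Finset.mem_insert_self i s)
    -- Exchange one factor at a time; the remaining factors have norm at most 1.
    calc ‖a i * ∏ j ∈ s, a j - b i * ∏ j ∈ s, b j‖
        = ‖(a i - b i) * ∏ j ∈ s, b j + a i * (∏ j ∈ s, a j - ∏ j ∈ s, b j)‖ := by ring_nf
      _ ≤ ‖a i - b i‖ * ‖∏ j ∈ s, b j‖ + ‖a i‖ * ‖∏ j ∈ s, a j - ∏ j ∈ s, b j‖ := by
          refine (norm_add_le _ _).trans ?_
          rw [norm_mul, norm_mul]
      _ ≤ ‖a i - b i‖ * 1 + 1 * ∑ j ∈ s, ‖a j - b j‖ := by gcongr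
      _ = _ := by ring

lemma integrable_pow_four_of_lintegral_le {S : Type*} [MeasurableSpace S] {ν : Measure S}
    {X : S → ℝ} (hX : Measurable X) {M : ℝ≥0}
    (h : ∫⁻ c, ENNReal.ofReal (X c ^ 4) ∂ν ≤ M) :
    Integrable (fun c => X c ^ 4) ν ∧ ∫ c, X c ^ 4 ∂ν ≤ M := by
  have h0 : 0 ≤ᵐ[ν] fun c => X c ^ 4 := ae_of_all _ fun c => by positivity
  have hm : AEStronglyMeasurable (fun c => X c ^ 4) ν := (hX.pow_const 4).aestronglyMeasurable
  refine ⟨⟨hm, ?_⟩, ?_⟩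
  · rw [hasFiniteIntegral_iff_ofReal h0]
    exact h.trans_lt ENNReal.coe_lt_top
  · rw [integral_eq_lintegral_of_nonneg_ae h0 hm]
    exact ENNReal.toReal_le_of_le_ofReal M.2 (by simpa using h)

/-- The characteristic function of a centred variable with bounded fourth moment is close to that
of a Gaussian variable with the same variance. -/
lemma norm_integral_exp_sub_gaussian_le {S : Type*} [MeasurableSpace S] (ν : Measure S)
    [IsProbabilityMeasure ν] {X : S → ℝ} (hX : Measurable X) (h2 : MemLp X 2 ν)
    (h0 : ∫ c, X c ∂ν = 0) {M : ℝ≥0} (h4 : ∫⁻ c, ENNReal.ofReal (X c ^ 4) ∂ν ≤ M)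
    {a δ : ℝ} (ha : |a| ≤ δ) :
    ‖∫ c, Complex.exp ((a * X c : ℝ) * Complex.I) ∂ν -
      Complex.exp ((-(a ^ 2 * Var[X; ν]) / 2 : ℝ))‖ ≤
      4 * (1 + M) * δ ^ 3 + (1 + M) ^ 2 * δ ^ 4 := by
  have hδ : 0 ≤ δ := (abs_nonneg a).trans ha
  obtain ⟨i4, b4⟩ := integrable_pow_four_of_lintegral_le hX h4
  have i2 : Integrable (fun c => X c ^ 2) ν := h2.integrable_sq
  have i1 : Integrable X ν := h2.integrable (by norm_num)
  have hvar : Var[X; ν] = ∫ c, X c ^ 2 ∂ν := variance_of_integral_eq_zero hX.aemeasurable h0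
  have hv0 : 0 ≤ Var[X; ν] := variance_nonneg X ν
  have hvM : Var[X; ν] ≤ 1 + M := by
    rw [hvar]
    calc ∫ c, X c ^ 2 ∂ν ≤ ∫ c, (1 + X c ^ 4) ∂ν :=
          integral_mono i2 ((integrable_const 1).add i4) fun c => by
            simp only
            nlinarith [sq_nonneg (X c ^ 2 - 1), sq_nonneg (X c ^ 2)]
      _ = 1 + ∫ c, X c ^ 4 ∂ν := by
          rw [integral_add (integrable_const 1) i4]; simp
      _ ≤ 1 + M := by linarith
  have ie : Integrable (fun c => Complex.exp ((a * X c : ℝ) * Complex.I)) ν := by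
    refine Integrable.of_bound (C := 1) ?_ (ae_of_all _ fun c => ?_)
    · exact (by fun_prop : Measurable _).aestronglyMeasurable
    · rw [Complex.norm_exp_ofReal_mul_I]
  have it : Integrable (fun c => (1 + (a * X c : ℝ) * Complex.I - ((a * X c : ℝ) : ℂ) ^ 2 / 2)) ν := by
    refine ((integrable_const _).add ?_).sub ?_
    · exact ((i1.const_mul a).ofReal).mul_const _
    · have := ((i2.const_mul (a ^ 2)).ofReal (𝕜 := ℂ)).div_const 2
      refine this.congr (ae_of_all _ fun c => ?_)
      simp only [RCLike.ofReal_eq_complex_ofReal] 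
      push_cast
      ring
  have et : ∫ c, (1 + (a * X c : ℝ) * Complex.I - ((a * X c : ℝ) : ℂ) ^ 2 / 2) ∂ν =
      ((1 - a ^ 2 * Var[X; ν] / 2 : ℝ) : ℂ) := by
    have e : ∀ c, (1 + (a * X c : ℝ) * Complex.I - ((a * X c : ℝ) : ℂ) ^ 2 / 2 : ℂ) =
        ((1 - a ^ 2 / 2 * X c ^ 2 : ℝ) : ℂ) + ((a * X c : ℝ) : ℂ) * Complex.I := by
      intro c; push_cast; ring
    simp_rw [e]
    rw [integral_add, integral_mul_const, integral_complex_ofReal, integral_complex_ofReal,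
      integral_sub (integrable_const _) (i2.const_mul _), integral_const_mul, integral_const_mul,
      h0, hvar]
    · simp; ring
    · exact ((integrable_const _).sub (i2.const_mul _)).ofReal
    · exact ((i1.const_mul a).ofReal).mul_const _
  have key1 : ‖∫ c, Complex.exp ((a * X c : ℝ) * Complex.I) ∂ν -
      ((1 - a ^ 2 * Var[X; ν] / 2 : ℝ) : ℂ)‖ ≤ 4 * (1 + M) * δ ^ 3 := by
    rw [← et, ← integral_sub ie it]
    calc _ ≤ ∫ c, 4 * δ ^ 3 * (1 + X c ^ 4) ∂ν := by
          refine norm_integral_le_of_norm_le (((integrable_const 1).add i4).const_mul _)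
            (ae_of_all _ fun c => ?_)
          refine (norm_exp_mul_I_sub_taylor_two_le _).trans ?_
          have hx : |X c| ^ 3 ≤ 1 + X c ^ 4 := by
            have : X c ^ 4 = |X c| ^ 4 := by rw [pow_abs, abs_of_nonneg (by positivity)]
            rw [this]
            have := abs_nonneg (X c)
            rcases le_total |X c| 1 with h | h
            · have := pow_le_one₀ (n := 3) this h
              have : 0 ≤ |X c| ^ 4 := by positivity
              linarith
            · have := pow_le_pow_right₀ h (show 3 ≤ 4 by norm_num)
              linarith
          rw [abs_mul, mul_pow, mul_assoc]
          gcongr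
      _ = 4 * δ ^ 3 * (1 + ∫ c, X c ^ 4 ∂ν) := by
          rw [integral_const_mul, integral_add (integrable_const 1) i4]; simp
      _ ≤ 4 * δ ^ 3 * (1 + M) := by gcongr
      _ = _ := by ring
  have key2 : ‖((1 - a ^ 2 * Var[X; ν] / 2 : ℝ) : ℂ) -
      Complex.exp ((-(a ^ 2 * Var[X; ν]) / 2 : ℝ))‖ ≤ (1 + M) ^ 2 * δ ^ 4 := by
    rw [← Complex.ofReal_exp, ← Complex.ofReal_sub, Complex.norm_real, Real.norm_eq_abs]
    set v := a ^ 2 * Var[X; ν] / 2 with hv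
    have hvn : 0 ≤ v := by positivity
    have hvb : v ≤ (1 + M) * δ ^ 2 := by
      have : a ^ 2 ≤ δ ^ 2 := by
        rw [← sq_abs a]; gcongr
      have : a ^ 2 * Var[X; ν] ≤ δ ^ 2 * (1 + M) := by gcongr
      have : 0 ≤ δ ^ 2 * (1 + M : ℝ) := by positivity
      linarith
    have e : -(a ^ 2 * Var[X; ν]) / 2 = -v := by rw [hv]; ring
    rw [e]
    have l1 : 1 - v ≤ Real.exp (-v) := Real.one_sub_le_exp_neg v
    -- Uses e^{-v} ≤ 1/(1+v) and (1 - v + v²)(1 + v) = 1 + v³ ≥ 1.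
    have l2 : Real.exp (-v) ≤ 1 - v + v ^ 2 := by
      have hexp : Real.exp (-v) * (1 + v) ≤ 1 := by
        have := Real.add_one_le_exp v
        calc Real.exp (-v) * (1 + v) ≤ Real.exp (-v) * Real.exp v := by gcongr; linarith
          _ = 1 := by rw [← Real.exp_add]; simp
      have : 1 ≤ (1 - v + v ^ 2) * (1 + v) := by nlinarith [pow_nonneg hvn 3]
      exact le_of_mul_le_mul_right (hexp.trans this) (by linarith)
    rw [abs_sub_comm, abs_of_nonneg (by linarith)]
    calc Real.exp (-v) - (1 - v) ≤ v ^ 2 := by linarith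
      _ ≤ ((1 + M) * δ ^ 2) ^ 2 := by gcongr
      _ = _ := by ring
  calc _ ≤ _ := norm_sub_le_norm_sub_add_norm_sub _ _ _
    _ ≤ _ := add_le_add key1 key2

/-- Quantitative Lyapunov central limit theorem for the characteristic function of a linear
combination of independent centred variables. -/
lemma norm_integral_exp_sum_sub_gaussian_le {ι : Type*} [Fintype ι] (ν : Measure (ι → ℝ))
    [IsProbabilityMeasure ν] (hind : iIndepFun (fun s (c : ι → ℝ) => c s) ν)
    (h0 : ∀ s, ∫ c, c s ∂ν = 0) (h2 : ∀ s, MemLp (fun c => c s) 2 ν) {M : ℝ≥0}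
    (h4 : ∀ s, ∫⁻ c, ENNReal.ofReal (c s ^ 4) ∂ν ≤ M) (a : ι → ℝ) {δ : ℝ}
    (ha : ∀ s, |a s| ≤ δ) :
    ‖∫ c, Complex.exp ((∑ s, a s * c s : ℝ) * Complex.I) ∂ν -
      Complex.exp ((-(∑ s, a s ^ 2 * Var[fun c => c s; ν]) / 2 : ℝ))‖ ≤
      Fintype.card ι * (4 * (1 + M) * δ ^ 3 + (1 + M) ^ 2 * δ ^ 4) := by
  have e1 : ∫ c, Complex.exp ((∑ s, a s * c s : ℝ) * Complex.I) ∂ν =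
      ∏ s, ∫ c, Complex.exp ((a s * c s : ℝ) * Complex.I) ∂ν := by
    -- Independence enters here: the characteristic function of the sum factorises.
    rw [← hind.integral_fun_prod_comp (f := fun s x => Complex.exp ((a s * x : ℝ) * Complex.I))
      (fun s => (measurable_pi_apply s).aemeasurable)
      (fun s => (by fun_prop : Measurable _).aestronglyMeasurable)]
    congr 1
    ext c
    rw [← Complex.exp_sum]
    push_cast
    rw [Finset.sum_mul]
  have e2 : Complex.exp ((-(∑ s, a s ^ 2 * Var[fun c => c s; ν]) / 2 : ℝ)) =
      ∏ s, Complex.exp ((-(a s ^ 2 * Var[fun c => c s; ν]) / 2 : ℝ)) := by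
    rw [← Complex.exp_sum, ← Complex.ofReal_sum, ← Finset.sum_div, Finset.sum_neg_distrib]
  rw [e1, e2]
  refine (norm_prod_sub_prod_le_sum _ _ _ (fun s _ => ?_) (fun s _ => ?_)).trans ?_
  · refine (norm_integral_le_of_norm_le_const (C := 1) (ae_of_all _ fun c => ?_)).trans (by simp)
    rw [Complex.norm_exp_ofReal_mul_I]
  · rw [← Complex.ofReal_exp, Complex.norm_real, Real.norm_eq_abs, Real.abs_exp,
      Real.exp_le_one_iff]
    have := variance_nonneg (fun c : ι → ℝ => c s) ν
    have : 0 ≤ a s ^ 2 * Var[fun c => c s; ν] := by positivity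
    linarith
  · refine (Finset.sum_le_card_nsmul _ _ _ fun s _ => norm_integral_exp_sub_gaussian_le ν
      (measurable_pi_apply s) (h2 s) (h0 s) (h4 s) (ha s)).trans_eq ?_
    rw [nsmul_eq_mul, Finset.card_univ]

/-! ### Autocovariances and the spectral density -/

lemma autocov_neg {Ω : Type*} [MeasurableSpace Ω] (P : Measure Ω) (V : ℕ → Ω → ℝ) (h : ℤ) :
    autocov P V (-h) = autocov P V h := by
  simp [autocov]

lemma IsStationary.cov_eq_autocov {Ω : Type*} [MeasurableSpace Ω] {P : Measure Ω}
    {V : ℕ → Ω → ℝ} (hV : IsStationary P V) {i j : ℕ} (hi : 1 ≤ i) (hj : 1 ≤ j) :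
    cov[V i, V j; P] = autocov P V ((i : ℤ) - j) := by
  rcases le_total i j with h | h
  · obtain ⟨k, rfl⟩ := Nat.exists_eq_add_of_le h
    rw [hV.cov i hi k, autocov]
    congr 3
    omega
  · obtain ⟨k, rfl⟩ := Nat.exists_eq_add_of_le h
    rw [covariance_comm, hV.cov j hj k, autocov]
    congr 3
    omega

/-- The quadratic form at x is the variance of ∑ x_i X_i. -/
lemma posSemidef_covariance {Ω : Type*} [MeasurableSpace Ω] (P : Measure Ω)
    [IsProbabilityMeasure P] {p : ℕ} (X : Fin p → Ω → ℝ) (hX : ∀ i, MemLp (X i) 2 P) :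
    (Matrix.of fun i j => cov[X i, X j; P]).PosSemidef := by
  refine Matrix.PosSemidef.of_dotProduct_mulVec_nonneg ?_ fun x => ?_
  · ext i j
    simp [covariance_comm]
  · have h : 0 ≤ Var[∑ i, x i • X i; P] := variance_nonneg _ _
    rw [variance_sum' fun i _ => (hX i).const_smul (x i)] at h
    convert! h using 1
    simp [dotProduct, Matrix.mulVec, Finset.mul_sum, covariance_smul_left, covariance_smul_right]
    refine Finset.sum_congr rfl fun i _ => Finset.sum_congr rfl fun j _ => ?_
    ring

/-- Absolute summability allows the real part to be taken term by term, giving a real cosine series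
that can be interchanged with sums over frequencies. -/
lemma two_pi_mul_spectralDensity {Ω : Type*} [MeasurableSpace Ω] {P : Measure Ω} {V : ℕ → Ω → ℝ}
    (h : Summable fun h : ℤ => |autocov P V h|) (lam : ℝ) :
    2 * Real.pi * spectralDensity P V lam = ∑' n : ℤ, autocov P V n * Real.cos (n * lam) := by
  have hs : Summable fun n : ℤ =>
      Complex.exp (-Complex.I * (n : ℂ) * (lam : ℂ)) * (autocov P V n : ℂ) := by
    refine Summable.of_norm (h.congr fun n => ?_)
    have : -Complex.I * (n : ℂ) * (lam : ℂ) = ((-(n * lam) : ℝ) : ℂ) * Complex.I := by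
      push_cast; ring
    rw [norm_mul, this, Complex.norm_exp_ofReal_mul_I, one_mul, Complex.norm_real,
      Real.norm_eq_abs]
  rw [spectralDensity, ← mul_assoc, mul_inv_cancel₀ (by positivity), one_mul, Complex.re_tsum hs]
  refine tsum_congr fun n => ?_
  have : -Complex.I * (n : ℂ) * (lam : ℂ) = ((-(n * lam) : ℝ) : ℂ) * Complex.I := by
    push_cast; ring
  rw [Complex.re_mul_ofReal, this, Complex.exp_ofReal_mul_I_re, Real.cos_neg, mul_comm]

/-! ### Cosine sums over the Fourier frequencies -/

/-- Telescoping: 2 sin(θ/2) cos(kθ) = sin(kθ + θ/2) - sin(kθ - θ/2). -/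
lemma two_mul_sin_mul_sum_cos (θ : ℝ) (N : ℕ) :
    2 * Real.sin (θ / 2) * ∑ k ∈ Finset.range N, Real.cos ((k + 1 : ℕ) * θ) =
      Real.sin ((2 * N + 1) * (θ / 2)) - Real.sin (θ / 2) := by
  induction N with
  | zero => simp
  | succ N ih =>
    rw [Finset.sum_range_succ, mul_add, ih]
    have e1 : (2 * ((N + 1 : ℕ) : ℝ) + 1) * (θ / 2) = (N + 1 : ℕ) * θ + θ / 2 := by ring
    have e2 : (2 * (N : ℝ) + 1) * (θ / 2) = (N + 1 : ℕ) * θ - θ / 2 := by push_cast; ring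
    rw [e1, e2, Real.sin_add, Real.sin_sub]
    ring

/-- The cosine sum over half of the Fourier frequencies is bounded. -/
lemma abs_sum_cos_freq_le_one {m : ℤ} (hm : m ≠ 0) {T : ℕ} (hT : m.natAbs < T) :
    |∑ k ∈ Finset.range (numFreq T), Real.cos (m * freq T (k + 1))| ≤ 1 := by
  have hT0 : (0 : ℝ) < T := by exact_mod_cast (by omega : 0 < T)
  set θ : ℝ := 2 * Real.pi * m / T with hθ
  have hsum : ∑ k ∈ Finset.range (numFreq T), Real.cos (m * freq T (k + 1)) =
      ∑ k ∈ Finset.range (numFreq T), Real.cos ((k + 1 : ℕ) * θ) := by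
    refine Finset.sum_congr rfl fun k _ => ?_
    congr 1
    rw [hθ, freq]
    ring
  rw [hsum]
  -- A zero would make T divide m, which is impossible for 0 < |m| < T.
  have hsin : Real.sin (θ / 2) ≠ 0 := by
    intro h0
    rw [Real.sin_eq_zero_iff] at h0
    obtain ⟨n, hn⟩ := h0
    have hpi := Real.pi_pos
    have : (n : ℝ) * T = m := by
      rw [hθ] at hn
      field_simp at hn
      linarith
    have h1 : n * T = m := by exact_mod_cast this
    have h2 : n ≠ 0 := by rintro rfl; simp at h1; exact hm h1.symm
    have h3 : m.natAbs = n.natAbs * T := by rw [← h1, Int.natAbs_mul, Int.natAbs_natCast]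
    have h4 : 1 ≤ n.natAbs := by omega
    nlinarith
  -- The upper end of the telescope has angle mπ for odd T (2N + 1 = T) and mπ - θ/2 for even T (2N
  -- + 1 = T - 1). Either way the telescoped difference is at most 2|sin(θ/2)|, which bounds the
  -- cosine sum by 1.
  have hend : |Real.sin ((2 * (numFreq T : ℝ) + 1) * (θ / 2))| ≤ |Real.sin (θ / 2)| := by
    rcases Nat.even_or_odd T with he | ho
    · have hN : 2 * numFreq T + 2 = T := by
        obtain ⟨r, hr⟩ := he
        unfold numFreq
        omega
      have hN' : (2 * (numFreq T : ℝ) + 1) = T - 1 := by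
        have := congrArg (Nat.cast : ℕ → ℝ) hN
        push_cast at this
        linarith
      have : (2 * (numFreq T : ℝ) + 1) * (θ / 2) = m * Real.pi - θ / 2 := by
        rw [hN', hθ]; field_simp
      rw [this, Real.sin_sub, Real.sin_int_mul_pi, zero_mul, zero_sub, abs_neg, abs_mul,
        Real.abs_cos_int_mul_pi, one_mul]
    · have hN : 2 * numFreq T + 1 = T := by
        obtain ⟨r, hr⟩ := ho
        unfold numFreq
        omega
      have hN' : (2 * (numFreq T : ℝ) + 1) = T := by
        have := congrArg (Nat.cast : ℕ → ℝ) hN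
        push_cast at this
        linarith
      have : (2 * (numFreq T : ℝ) + 1) * (θ / 2) = m * Real.pi := by
        rw [hN', hθ]; field_simp
      rw [this, Real.sin_int_mul_pi]
      simp
  have key := congrArg abs (two_mul_sin_mul_sum_cos θ (numFreq T))
  rw [abs_mul, abs_mul, abs_two] at key
  have hpos : 0 < |Real.sin (θ / 2)| := abs_pos.mpr hsin
  have := abs_sub (Real.sin ((2 * (numFreq T : ℝ) + 1) * (θ / 2))) (Real.sin (θ / 2))
  by_contra hcon
  push Not at hcon
  nlinarith

lemma two_mul_numFreq_le (T : ℕ) : 2 * (numFreq T : ℝ) ≤ T := by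
  have : 2 * numFreq T ≤ T := by unfold numFreq; omega
  exact_mod_cast this

lemma le_two_mul_numFreq_add_two (T : ℕ) : (T : ℝ) ≤ 2 * numFreq T + 2 := by
  have : T ≤ 2 * numFreq T + 2 := by unfold numFreq; omega
  exact_mod_cast this

/-- Asymptotic orthogonality of the cosines over half of the Fourier frequencies. -/
lemma tendsto_mean_cos_freq (m : ℤ) :
    Tendsto (fun T : ℕ => 2 / (T : ℝ) *
      ∑ k ∈ Finset.range (numFreq T), Real.cos (m * freq T (k + 1))) atTop
      (𝓝 (if m = 0 then 1 else 0)) := by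
  have h2 : Tendsto (fun T : ℕ => 2 / (T : ℝ)) atTop (𝓝 0) :=
    tendsto_const_div_atTop_nhds_zero_nat 2
  split_ifs with hm
  · subst hm
    have h1 : Tendsto (fun T : ℕ => 1 - 2 / (T : ℝ)) atTop (𝓝 1) := by
      simpa using h2.const_sub 1
    refine tendsto_of_tendsto_of_tendsto_of_le_of_le' h1 tendsto_const_nhds ?_ ?_
    · filter_upwards [eventually_gt_atTop 0] with T hT
      have hT' : (0 : ℝ) < T := by exact_mod_cast hT
      simp only [Int.cast_zero, zero_mul, Real.cos_zero, Finset.sum_const, Finset.card_range,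
        nsmul_eq_mul, mul_one]
      have := le_two_mul_numFreq_add_two T
      rw [← sub_nonneg]
      have e : 2 / (T : ℝ) * numFreq T - (1 - 2 / T) = (2 * numFreq T + 2 - T) / T := by
        field_simp
        ring
      rw [e]
      exact div_nonneg (by linarith) hT'.le
    · filter_upwards [eventually_gt_atTop 0] with T hT
      have hT' : (0 : ℝ) < T := by exact_mod_cast hT
      simp only [Int.cast_zero, zero_mul, Real.cos_zero, Finset.sum_const, Finset.card_range,
        nsmul_eq_mul, mul_one]
      rw [div_mul_eq_mul_div, div_le_one hT']
      exact two_mul_numFreq_le T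
  · refine squeeze_zero_norm' ?_ h2
    filter_upwards [eventually_gt_atTop m.natAbs] with T hT
    rw [norm_mul, Real.norm_of_nonneg (by positivity : (0 : ℝ) ≤ 2 / T)]
    exact mul_le_of_le_one_right (by positivity) (abs_sum_cos_freq_le_one hm hT)

/-- The empirical Fourier coefficients of the spectral density over half of the Fourier
frequencies converge to the auto-covariances. -/
lemma tendsto_mean_spectralDensity_mul_cos {Ω : Type*} [MeasurableSpace Ω] {P : Measure Ω}
    {V : ℕ → Ω → ℝ} (hs : Summable fun h : ℤ => |autocov P V h|) (h : ℤ) :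
    Tendsto (fun T : ℕ => 4 / (T : ℝ) * ∑ k ∈ Finset.range (numFreq T),
      Real.cos (h * freq T (k + 1)) * (Real.pi * spectralDensity P V (freq T (k + 1)))) atTop
      (𝓝 (autocov P V h)) := by
  -- `D T n` is the normalised inner product of the cosines of orders h and n; it becomes the
  -- coefficient of γ(n) once f is expanded and the sums are swapped.
  set D : ℕ → ℤ → ℝ := fun T n => 2 / (T : ℝ) * ∑ k ∈ Finset.range (numFreq T),
    Real.cos (h * freq T (k + 1)) * Real.cos (n * freq T (k + 1)) with hD
  have hDb : ∀ T n, |D T n| ≤ 1 := by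
    intro T n
    rcases Nat.eq_zero_or_pos T with rfl | hT
    · simp [hD]
    have hT' : (0 : ℝ) < T := by exact_mod_cast hT
    rw [hD, abs_mul, abs_of_nonneg (by positivity : (0 : ℝ) ≤ 2 / T)]
    have hb : |∑ k ∈ Finset.range (numFreq T),
        Real.cos (h * freq T (k + 1)) * Real.cos (n * freq T (k + 1))| ≤ numFreq T := by
      refine (Finset.abs_sum_le_sum_abs _ _).trans ?_
      refine (Finset.sum_le_card_nsmul _ _ 1 fun k _ => ?_).trans_eq (by simp)
      rw [abs_mul]
      exact mul_le_one₀ (Real.abs_cos_le_one _) (abs_nonneg _) (Real.abs_cos_le_one _)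
    calc _ ≤ 2 / (T : ℝ) * numFreq T := by gcongr
      _ ≤ 1 := by
        rw [div_mul_eq_mul_div, div_le_one hT']
        exact two_mul_numFreq_le T
  have hDlim : ∀ n, Tendsto (fun T => D T n) atTop
      (𝓝 (((if n - h = 0 then 1 else 0) + (if n + h = 0 then 1 else 0)) / 2)) := by
    intro n
    refine (((tendsto_mean_cos_freq (n - h)).add (tendsto_mean_cos_freq (n + h))).div_const
      2).congr fun T => ?_
    rw [hD, ← mul_add, ← Finset.sum_add_distrib, mul_div_assoc, Finset.sum_div]
    congr 1
    refine Finset.sum_congr rfl fun k _ => ?_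
    push_cast
    rw [sub_mul, add_mul, Real.cos_sub, Real.cos_add]
    ring
  have hser : ∀ T : ℕ, 4 / (T : ℝ) * ∑ k ∈ Finset.range (numFreq T),
      Real.cos (h * freq T (k + 1)) * (Real.pi * spectralDensity P V (freq T (k + 1))) =
      ∑' n : ℤ, autocov P V n * D T n := by
    intro T
    have hsum : ∀ lam : ℝ, Summable fun n : ℤ => autocov P V n * Real.cos (n * lam) := by
      intro lam
      refine Summable.of_norm_bounded hs fun n => ?_
      rw [norm_mul]
      exact mul_le_of_le_one_right (abs_nonneg _) (Real.abs_cos_le_one _)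
    have e1 : 4 / (T : ℝ) * ∑ k ∈ Finset.range (numFreq T),
        Real.cos (h * freq T (k + 1)) * (Real.pi * spectralDensity P V (freq T (k + 1))) =
        ∑ k ∈ Finset.range (numFreq T), 2 / (T : ℝ) * Real.cos (h * freq T (k + 1)) *
          ∑' n : ℤ, autocov P V n * Real.cos (n * freq T (k + 1)) := by
      rw [Finset.mul_sum]
      refine Finset.sum_congr rfl fun k _ => ?_
      rw [← two_pi_mul_spectralDensity hs]
      ring
    rw [e1]
    simp_rw [← tsum_mul_left]
    rw [← Summable.tsum_finsetSum fun k _ => (hsum _).mul_left _]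
    refine tsum_congr fun n => ?_
    rw [hD]
    simp only
    rw [Finset.mul_sum, Finset.mul_sum]
    exact Finset.sum_congr rfl fun k _ => by ring
  simp_rw [hser]
  -- Since |`D T n`| ≤ 1, the summable |γ(n)| dominates uniformly in T.
  have hlim := tendsto_tsum_of_dominated_convergence (𝓕 := atTop)
    (f := fun (T : ℕ) (n : ℤ) => autocov P V n * D T n) hs
    (fun n => (hDlim n).const_mul (autocov P V n)) (Eventually.of_forall fun T n => by
      rw [norm_mul]
      exact mul_le_of_le_one_right (abs_nonneg _) (hDb T n))
  convert! hlim using 2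
  -- In the limit n = h and n = -h each carry weight 1/2 (both at n = 0 if h = 0), and evenness of γ
  -- makes the total γ(h).
  have e2 : ∀ n : ℤ, autocov P V n *
      (((if n - h = 0 then 1 else 0) + (if n + h = 0 then 1 else 0)) / 2) =
      (if n = h then autocov P V h / 2 else 0) + (if n = -h then autocov P V h / 2 else 0) := by
    intro n
    have h1 : (n - h = 0) ↔ n = h := sub_eq_zero
    have h2 : (n + h = 0) ↔ n = -h := add_eq_zero_iff_eq_neg
    simp only [h1, h2]
    by_cases a : n = h <;> by_cases b : n = -h
    · rw [if_pos a, if_pos b, if_pos a, if_pos b, a]; ring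
    · rw [if_pos a, if_neg b, if_pos a, if_neg b, a]; ring
    · rw [if_neg a, if_pos b, if_neg a, if_pos b, b, autocov_neg]; ring
    · rw [if_neg a, if_neg b, if_neg a, if_neg b]; ring
  simp_rw [e2]
  rw [Summable.tsum_add, tsum_ite_eq, tsum_ite_eq]
  · ring
  · exact (hasSum_ite_eq _ _).summable
  · exact (hasSum_ite_eq _ _).summable

/-! ### The bootstrap vector as a linear image of the coefficients -/

/-- The weight of each bootstrap Fourier coefficient in `Z*(t)`. -/
noncomputable def bootWeight (T t : ℕ) : Fin (numFreq T) ⊕ Fin (numFreq T) → ℝ :=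
  Sum.elim (fun k => 2 / Real.sqrt T * Real.cos (freq T (k + 1) * t))
    (fun k => -(2 / Real.sqrt T * Real.sin (freq T (k + 1) * t)))

/-- The Fourier frequency that each bootstrap Fourier coefficient belongs to. -/
noncomputable def coefFreq (T : ℕ) : Fin (numFreq T) ⊕ Fin (numFreq T) → ℝ :=
  Sum.elim (fun k => freq T (k + 1)) (fun k => freq T (k + 1))

/-- The linear map sending the bootstrap Fourier coefficients to the bootstrap vector. -/
noncomputable def bootMap {p : ℕ} (l : Fin p → ℕ) (T : ℕ)
    (c : Fin (numFreq T) ⊕ Fin (numFreq T) → ℝ) : EuclideanSpace ℝ (Fin p) :=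
  WithLp.toLp 2 fun i => ∑ s, bootWeight T (l i) s * c s

lemma measurable_bootMap {p : ℕ} (l : Fin p → ℕ) (T : ℕ) : Measurable (bootMap l T) := by
  unfold bootMap
  fun_prop

lemma sum_fin_succ_eq_sum_Icc (N : ℕ) (f : ℕ → ℝ) :
    ∑ k : Fin N, f (k + 1) = ∑ k ∈ Finset.Icc 1 N, f k := by
  rw [Fin.sum_univ_eq_sum_range (fun k => f (k + 1)) N, Finset.range_eq_Ico,
    Finset.sum_Ico_add' f 0 N 1]
  rfl

lemma zStar_eq_sum {Ω : Type*} (xs ys : ℕ → ℕ → Ω → ℝ) (T t : ℕ) (ω : Ω) :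
    zStar xs ys T t ω = ∑ s, bootWeight T t s * bootCoef xs ys T ω s := by
  rw [zStar, inverseFFT_eq, Complex.ofReal_re, Fintype.sum_sum_type, ← sum_fin_succ_eq_sum_Icc,
    Finset.mul_sum, ← Finset.sum_add_distrib]
  refine Finset.sum_congr rfl fun k _ => ?_
  simp only [bootWeight, bootCoef, Sum.elim_inl, Sum.elim_inr]
  ring

lemma bootVec_eq_bootMap {Ω : Type*} (xs ys : ℕ → ℕ → Ω → ℝ) {p : ℕ} (l : Fin p → ℕ) (T : ℕ) :
    bootVec xs ys l T = bootMap l T ∘ bootCoef xs ys T := by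
  ext ω i
  simp [bootVec, bootMap, zStar_eq_sum]

lemma abs_bootWeight_le (T t : ℕ) (s : Fin (numFreq T) ⊕ Fin (numFreq T)) :
    |bootWeight T t s| ≤ 2 / Real.sqrt T := by
  rcases s with k | k
  · simp only [bootWeight, Sum.elim_inl]
    rw [abs_mul, abs_of_nonneg (by positivity : 0 ≤ 2 / Real.sqrt T)]
    exact mul_le_of_le_one_right (by positivity) (Real.abs_cos_le_one _)
  · simp only [bootWeight, Sum.elim_inr]
    rw [abs_neg, abs_mul, abs_of_nonneg (by positivity : 0 ≤ 2 / Real.sqrt T)]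
    exact mul_le_of_le_one_right (by positivity) (Real.abs_sin_le_one _)

/-- The weights of the bootstrap Fourier coefficients in the linear combination of the bootstrap
vector with coefficients `u`. -/
noncomputable def dirWeight {p : ℕ} (l : Fin p → ℕ) (T : ℕ) (u : EuclideanSpace ℝ (Fin p))
    (s : Fin (numFreq T) ⊕ Fin (numFreq T)) : ℝ :=
  ∑ i, u i * bootWeight T (l i) s

lemma inner_bootMap {p : ℕ} (l : Fin p → ℕ) (T : ℕ) (u : EuclideanSpace ℝ (Fin p))
    (c : Fin (numFreq T) ⊕ Fin (numFreq T) → ℝ) :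
    inner ℝ (bootMap l T c) u = ∑ s, dirWeight l T u s * c s := by
  simp only [bootMap, dirWeight, PiLp.inner_apply, RCLike.inner_apply, conj_trivial,
    Finset.mul_sum, Finset.sum_mul]
  rw [Finset.sum_comm]
  exact Finset.sum_congr rfl fun s _ => Finset.sum_congr rfl fun i _ => by ring

lemma abs_dirWeight_le {p : ℕ} (l : Fin p → ℕ) (T : ℕ) (u : EuclideanSpace ℝ (Fin p))
    (s : Fin (numFreq T) ⊕ Fin (numFreq T)) :
    |dirWeight l T u s| ≤ (2 * ∑ i, |u i|) / Real.sqrt T := by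
  calc |dirWeight l T u s| ≤ ∑ i, |u i * bootWeight T (l i) s| := Finset.abs_sum_le_sum_abs _ _
    _ ≤ ∑ i, |u i| * (2 / Real.sqrt T) := by
        refine Finset.sum_le_sum fun i _ => ?_
        rw [abs_mul]
        exact mul_le_mul_of_nonneg_left (abs_bootWeight_le _ _ _) (abs_nonneg _)
    _ = _ := by rw [← Finset.sum_mul]; ring

/-- The x- and y-coefficients at λ_k share the target variance π f(λ_k), so their squared weights
add up through cos a cos b + sin a sin b = cos(a - b). What remains is a finite combination of
empirical Fourier coefficients of f at the lags l_i - l_j. -/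
lemma tendsto_sum_sq_dirWeight_mul_spectralDensity {Ω : Type*} [MeasurableSpace Ω]
    {P : Measure Ω} {V : ℕ → Ω → ℝ} (hs : Summable fun h : ℤ => |autocov P V h|) {p : ℕ}
    (l : Fin p → ℕ) (u : EuclideanSpace ℝ (Fin p)) :
    Tendsto (fun T : ℕ => ∑ s, dirWeight l T u s ^ 2 * (Real.pi * spectralDensity P V (coefFreq T s))) atTop
      (𝓝 (∑ i, ∑ j, u i * u j * autocov P V ((l i : ℤ) - l j))) := by
  refine (tendsto_finsetSum _ fun i _ => tendsto_finsetSum _ fun j _ =>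
    (tendsto_mean_spectralDensity_mul_cos hs ((l i : ℤ) - l j)).const_mul (u i * u j)).congr
    fun T => ?_
  have hsq : (2 / Real.sqrt T) * (2 / Real.sqrt T) = 4 / (T : ℝ) := by
    rw [div_mul_div_comm, Real.mul_self_sqrt (Nat.cast_nonneg T)]
    norm_num
  have hk : ∀ k : Fin (numFreq T), dirWeight l T u (Sum.inl k) ^ 2 +
      dirWeight l T u (Sum.inr k) ^ 2 = ∑ i, ∑ j, u i * u j *
        (4 / (T : ℝ) * Real.cos (((l i : ℤ) - l j : ℤ) * freq T (k + 1))) := by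
    intro k
    simp only [dirWeight, sq, Finset.sum_mul_sum, bootWeight, Sum.elim_inl, Sum.elim_inr,
      ← Finset.sum_add_distrib]
    refine Finset.sum_congr rfl fun i _ => Finset.sum_congr rfl fun j _ => ?_
    push_cast
    rw [← hsq, sub_mul, Real.cos_sub, mul_comm (freq T (k + 1)), mul_comm (freq T (k + 1))]
    ring
  rw [Fintype.sum_sum_type, ← Finset.sum_add_distrib]
  simp only [coefFreq, Sum.elim_inl, Sum.elim_inr, ← add_mul, hk]
  simp only [Finset.sum_mul]
  symm
  rw [Finset.sum_comm]
  refine Finset.sum_congr rfl fun i _ => ?_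
  rw [Finset.sum_comm]
  refine Finset.sum_congr rfl fun j _ => ?_
  rw [← Fin.sum_univ_eq_sum_range (fun k : ℕ =>
    Real.cos ((((l i : ℤ) - l j : ℤ) : ℝ) * freq T (k + 1)) *
      (Real.pi * spectralDensity P V (freq T (k + 1)))), Finset.mul_sum, Finset.mul_sum]
  exact Finset.sum_congr rfl fun k _ => by ring

/-! ### Central limit theorem for admissible laws -/

/-- A law of Fourier coefficients that is independent, centred, has variances within `δ` of
`π f(λ_k)` and fourth moments at most `M`. -/
structure IsAdmissible {Ω : Type*} [MeasurableSpace Ω] (P : Measure Ω) (V : ℕ → Ω → ℝ) (T : ℕ)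
    (δ : ℝ) (M : ℝ≥0) (ν : Measure (Fin (numFreq T) ⊕ Fin (numFreq T) → ℝ)) : Prop where
  isProb : IsProbabilityMeasure ν
  indep : iIndepFun (fun s (c : Fin (numFreq T) ⊕ Fin (numFreq T) → ℝ) => c s) ν
  centered : ∀ s, ∫ c, c s ∂ν = 0
  variance : ∀ s, VarWithin ν (fun c => c s) (Real.pi * spectralDensity P V (coefFreq T s)) δ
  fourth : ∀ s, ∫⁻ c, ENNReal.ofReal (c s ^ 4) ∂ν ≤ M

lemma card_sum_numFreq_le (T : ℕ) :
    (Fintype.card (Fin (numFreq T) ⊕ Fin (numFreq T)) : ℝ) ≤ T := by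
  have := two_mul_numFreq_le T
  simp only [Fintype.card_sum, Fintype.card_fin]
  push_cast
  linarith

/-- Each squared weight is at most (2 ∑|u_i|)²/T and there are at most T of them, so the factor T
cancels. -/
lemma IsAdmissible.abs_sum_variance_sub_le {Ω : Type*} [MeasurableSpace Ω] {P : Measure Ω}
    {V : ℕ → Ω → ℝ} {T : ℕ} (hT : 0 < T) {δ : ℝ} (hδ : 0 ≤ δ) {M : ℝ≥0}
    {ν : Measure (Fin (numFreq T) ⊕ Fin (numFreq T) → ℝ)} (h : IsAdmissible P V T δ M ν) {p : ℕ}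
    (l : Fin p → ℕ) (u : EuclideanSpace ℝ (Fin p)) :
    |∑ s, dirWeight l T u s ^ 2 * Var[fun c => c s; ν] -
      ∑ s, dirWeight l T u s ^ 2 * (Real.pi * spectralDensity P V (coefFreq T s))| ≤
      (2 * ∑ i, |u i|) ^ 2 * δ := by
  have hT' : (0 : ℝ) < T := by exact_mod_cast hT
  rw [← Finset.sum_sub_distrib]
  refine (Finset.abs_sum_le_sum_abs _ _).trans ?_
  refine (Finset.sum_le_card_nsmul _ _ (((2 * ∑ i, |u i|) / Real.sqrt T) ^ 2 * δ)
    fun s _ => ?_).trans ?_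
  · rw [← mul_sub, abs_mul, abs_of_nonneg (sq_nonneg _), ← sq_abs (dirWeight l T u s)]
    have := (h.variance s).2
    gcongr
    exact abs_dirWeight_le l T u s
  · rw [nsmul_eq_mul, Finset.card_univ, div_pow, Real.sq_sqrt hT'.le]
    calc _ ≤ (T : ℝ) * ((2 * ∑ i, |u i|) ^ 2 / T * δ) := by
          gcongr
          exact_mod_cast card_sum_numFreq_le T
      _ = _ := by field_simp

/-- The quantitative Lyapunov bound with weights at most K/√T, K = 2 ∑|u_i|, summed over at most T
coefficients. -/
lemma IsAdmissible.norm_charFun_sub_le {Ω : Type*} [MeasurableSpace Ω] {P : Measure Ω}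
    {V : ℕ → Ω → ℝ} {T : ℕ} (hT : 0 < T) {δ : ℝ} {M : ℝ≥0}
    {ν : Measure (Fin (numFreq T) ⊕ Fin (numFreq T) → ℝ)} (h : IsAdmissible P V T δ M ν) {p : ℕ}
    (l : Fin p → ℕ) (u : EuclideanSpace ℝ (Fin p)) :
    ‖charFun (ν.map (bootMap l T)) u -
      Complex.exp ((-(∑ s, dirWeight l T u s ^ 2 * Var[fun c => c s; ν]) / 2 : ℝ))‖ ≤
      4 * (1 + M) * (2 * ∑ i, |u i|) ^ 3 / Real.sqrt T +
        (1 + M) ^ 2 * (2 * ∑ i, |u i|) ^ 4 / T := by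
  have hT' : (0 : ℝ) < T := by exact_mod_cast hT
  have := h.isProb
  have key := norm_integral_exp_sum_sub_gaussian_le ν h.indep h.centered
    (fun s => (h.variance s).1) h.fourth (dirWeight l T u) (abs_dirWeight_le l T u)
  rw [charFun_apply, integral_map (measurable_bootMap l T).aemeasurable
    (by fun_prop : Measurable _).aestronglyMeasurable]
  simp_rw [inner_bootMap]
  refine key.trans ?_
  set K := 2 * ∑ i, |u i|
  have hK : 0 ≤ K := by positivity
  have hs : Real.sqrt T ^ 2 = T := Real.sq_sqrt hT'.le
  have hs0 : 0 < Real.sqrt T := Real.sqrt_pos.mpr hT'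
  have hM : (0 : ℝ) ≤ M := M.2
  calc _ ≤ (T : ℝ) * (4 * (1 + M) * (K / Real.sqrt T) ^ 3 +
        (1 + M) ^ 2 * (K / Real.sqrt T) ^ 4) := by
        refine mul_le_mul_of_nonneg_right (card_sum_numFreq_le T) ?_
        positivity
    _ = Real.sqrt T ^ 2 * (4 * (1 + M) * (K / Real.sqrt T) ^ 3 +
        (1 + M) ^ 2 * (K / Real.sqrt T) ^ 4) := by rw [hs]
    _ = 4 * (1 + M) * K ^ 3 / Real.sqrt T + (1 + M) ^ 2 * K ^ 4 / Real.sqrt T ^ 2 := by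
        field_simp
    _ = _ := by rw [hs]

/-- Deterministic central limit theorem: along admissible laws with variance errors tending to
zero, the bootstrap vector converges weakly to the Gaussian limit. -/
lemma tendsto_integral_of_isAdmissible {Ω : Type*} [MeasurableSpace Ω] {P : Measure Ω}
    [IsProbabilityMeasure P] {V : ℕ → Ω → ℝ} (hP : AssumptionP1 P V) {p : ℕ} (l : Fin p → ℕ)
    (hl : ∀ i, 1 ≤ l i) {M : ℝ≥0} {T : ℕ → ℕ} (hT : Tendsto T atTop atTop) {δ : ℕ → ℝ}
    (hδ0 : ∀ n, 0 ≤ δ n) (hδ : Tendsto δ atTop (𝓝 0))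
    (ν : ∀ n, Measure (Fin (numFreq (T n)) ⊕ Fin (numFreq (T n)) → ℝ))
    (hν : ∀ n, IsAdmissible P V (T n) (δ n) M (ν n)) (g : EuclideanSpace ℝ (Fin p) →ᵇ ℝ) :
    Tendsto (fun n => ∫ z, g z ∂((ν n).map (bootMap l (T n)))) atTop
      (𝓝 (∫ z, g z ∂(multivariateGaussian 0
        (Matrix.of fun i j => cov[V (l i), V (l j); P])))) := by
  have hprob : ∀ n, IsProbabilityMeasure ((ν n).map (bootMap l (T n))) := fun n =>
    have := (hν n).isProb
    Measure.isProbabilityMeasure_map (measurable_bootMap l (T n)).aemeasurable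
  let μ : ℕ → ProbabilityMeasure (EuclideanSpace ℝ (Fin p)) := fun n => ⟨_, hprob n⟩
  let μ₀ : ProbabilityMeasure (EuclideanSpace ℝ (Fin p)) :=
    ⟨multivariateGaussian 0 (Matrix.of fun i j => cov[V (l i), V (l j); P]), inferInstance⟩
  suffices h : Tendsto μ atTop (𝓝 μ₀) from
    ProbabilityMeasure.tendsto_iff_forall_integral_tendsto.mp h g
  refine ProbabilityMeasure.tendsto_of_tendsto_charFun fun u => ?_
  -- The Gaussian characteristic function formula requires a positive semidefinite covariance
  -- matrix.
  have hpsd := posSemidef_covariance P (fun i => V (l i))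
    fun i => hP.stationary.memLp (l i) (hl i)
  set q : ℝ := ∑ i, ∑ j, u i * u j * autocov P V ((l i : ℤ) - l j) with hq
  have hlimit : charFun (μ₀ : Measure (EuclideanSpace ℝ (Fin p))) u =
      Complex.exp ((-q / 2 : ℝ)) := by
    change charFun (multivariateGaussian 0 _) u = _
    rw [charFun_multivariateGaussian hpsd]
    congr 1
    have : dotProduct u.ofLp
        (Matrix.mulVec (Matrix.of fun i j => cov[V (l i), V (l j); P]) u.ofLp) = q := by
      simp only [dotProduct, Matrix.mulVec, Matrix.of_apply, hq, Finset.mul_sum]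
      refine Finset.sum_congr rfl fun i _ => Finset.sum_congr rfl fun j _ => ?_
      rw [hP.stationary.cov_eq_autocov (hl i) (hl j)]
      ring
    rw [this]
    simp
    ring
  rw [hlimit]
  set K := 2 * ∑ i, |u i| with hK
  have hTR : Tendsto (fun n => (T n : ℝ)) atTop atTop := tendsto_natCast_atTop_atTop.comp hT
  have hTpos : ∀ᶠ n in atTop, 0 < T n := hT.eventually_gt_atTop 0
  have hQ : Tendsto (fun n => ∑ s, dirWeight l (T n) u s ^ 2 * Var[fun c => c s; ν n]) atTop
      (𝓝 q) := by
    have h1 := (tendsto_sum_sq_dirWeight_mul_spectralDensity hP.summable l u).comp hT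
    have h2 : Tendsto (fun n => K ^ 2 * δ n) atTop (𝓝 0) := by simpa using hδ.const_mul (K ^ 2)
    have h3 : Tendsto (fun n => ∑ s, dirWeight l (T n) u s ^ 2 * Var[fun c => c s; ν n] -
        ∑ s, dirWeight l (T n) u s ^ 2 * (Real.pi * spectralDensity P V (coefFreq (T n) s)))
        atTop (𝓝 0) := squeeze_zero_norm' (hTpos.mono fun n hn =>
      (hν n).abs_sum_variance_sub_le hn (hδ0 n) l u) h2
    simpa [Function.comp_def] using h3.add h1
  have hexp : Tendsto (fun n => Complex.exp
      ((-(∑ s, dirWeight l (T n) u s ^ 2 * Var[fun c => c s; ν n]) / 2 : ℝ))) atTop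
      (𝓝 (Complex.exp ((-q / 2 : ℝ)))) :=
    ((by fun_prop : Continuous fun x : ℝ => Complex.exp ((-x / 2 : ℝ))).tendsto q).comp hQ
  have hbound : Tendsto (fun n => 4 * (1 + M) * K ^ 3 / Real.sqrt (T n) +
      (1 + M) ^ 2 * K ^ 4 / (T n : ℝ)) atTop (𝓝 0) := by
    simpa using (tendsto_const_nhds.div_atTop (Real.tendsto_sqrt_atTop.comp hTR)).add
      (tendsto_const_nhds.div_atTop hTR)
  have hdiff := squeeze_zero_norm' (hTpos.mono fun n hn => (hν n).norm_charFun_sub_le hn l u)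
    hbound
  have hfinal := hdiff.add hexp
  simp only [sub_add_cancel, zero_add] at hfinal
  exact hfinal

/-- Uniform version over all admissible laws. -/
lemma exists_isAdmissible_dist_integral_lt {Ω : Type*} [MeasurableSpace Ω] {P : Measure Ω}
    [IsProbabilityMeasure P] {V : ℕ → Ω → ℝ} (hP : AssumptionP1 P V) {p : ℕ} (l : Fin p → ℕ)
    (hl : ∀ i, 1 ≤ l i) (M : ℝ≥0) (g : EuclideanSpace ℝ (Fin p) →ᵇ ℝ) {ε : ℝ} (hε : 0 < ε) :
    ∃ δ : ℝ, 0 < δ ∧ ∃ T₀ : ℕ, ∀ T, T₀ ≤ T → ∀ ν, IsAdmissible P V T δ M ν →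
      dist (∫ z, g z ∂(ν.map (bootMap l T)))
        (∫ z, g z ∂(multivariateGaussian 0
          (Matrix.of fun i j => cov[V (l i), V (l j); P]))) < ε := by
  -- If uniformity failed, the choices δ = 1/(n+1) and T₀ = n would give a sequence of admissible
  -- laws staying ε away from the limit, against the sequential theorem.
  by_contra hcon
  push Not at hcon
  choose T hT ν hν hfar using fun n : ℕ => hcon (1 / ((n : ℝ) + 1)) (by positivity) n
  have hlim := tendsto_integral_of_isAdmissible hP l hl (tendsto_atTop_mono hT tendsto_id)
    (fun n => by positivity) tendsto_one_div_add_atTop_nhds_zero_nat ν hν g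
  obtain ⟨n, hn⟩ := ((Metric.tendsto_nhds.mp hlim) ε hε).exists
  exact absurd hn (not_lt.mpr (hfar n))

/-! ### From admissible laws to convergence in probability -/

/-- Conditional distributions commute with measurable maps, but only almost surely, since they are
determined only up to null sets. -/
lemma condLaw_bootVec {Ω : Type*} [MeasurableSpace Ω] (P : Measure Ω) [IsProbabilityMeasure P]
    {V : ℕ → Ω → ℝ} (hV : ∀ i, 1 ≤ i → Measurable (V i)) {xs ys : ℕ → ℕ → Ω → ℝ}
    (hxs : ∀ T k, Measurable (xs T k)) (hys : ∀ T k, Measurable (ys T k)) {p : ℕ}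
    (l : Fin p → ℕ) (T : ℕ) :
    ∀ᵐ ω ∂P, condLaw P V T (bootVec xs ys l T) ω =
      (condLaw P V T (bootCoef xs ys T) ω).map (bootMap l T) := by
  have hobs : Measurable (observed V T) :=
    measurable_pi_lambda _ fun i => hV (i + 1) (Nat.le_add_left _ _)
  have hcoef : Measurable (bootCoef xs ys T) := by
    refine measurable_pi_lambda _ fun s => ?_
    rcases s with k | k
    · exact hxs T (k + 1)
    · exact hys T (k + 1)
  have h := ae_of_ae_map hobs.aemeasurable
    (condDistrib_comp (observed V T) (μ := P) hcoef.aemeasurable (measurable_bootMap l T))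
  filter_upwards [h] with ω hω
  rw [condLaw, bootVec_eq_bootMap, hω, Kernel.map_apply _ (measurable_bootMap l T)]
  rfl

end TFT

theorem corollary3p2 {Ω : Type*} [MeasurableSpace Ω] (P : MeasureTheory.Measure Ω)
    [MeasureTheory.IsProbabilityMeasure P]
    (V : ℕ → Ω → ℝ) (hV : ∀ i, 1 ≤ i → Measurable (V i))
    (xs ys : ℕ → ℕ → Ω → ℝ)
    (hxs : ∀ T k, Measurable (xs T k)) (hys : ∀ T k, Measurable (ys T k))
    (hP1 : TFT.AssumptionP1 P V) (hB1 : TFT.AssumptionB1 P V xs ys)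
    (hB2 : TFT.AssumptionB2 P V xs ys) (hB3 : TFT.AssumptionB3 P V xs ys)
    {p : ℕ} (l : Fin p → ℕ) (hl : ∀ i, 1 ≤ l i) :
    TFT.TendstoWeaklyInProb P
      (fun T => TFT.condLaw P V T (TFT.bootVec xs ys l T))
      (ProbabilityTheory.multivariateGaussian 0
        (Matrix.of fun i j => ProbabilityTheory.covariance (V (l i)) (V (l j)) P)) := by
  intro g
  rw [tendstoInMeasure_iff_dist]
  intro ε hε
  obtain ⟨Cx, hCx⟩ := hB3.fourth_x
  obtain ⟨Cy, hCy⟩ := hB3.fourth_y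
  -- The fourth-moment bound takes slack 1 in each o_P(1) term, so one constant serves both
  -- families.
  obtain ⟨δ, hδ, T₀, hT₀⟩ := TFT.exists_isAdmissible_dist_integral_lt hP1 l hl
    (max (Cx + 1) (Cy + 1)) g hε
  have hsum := (((hB2.var_x δ hδ).add (hB2.var_y δ hδ)).add (hCx 1 one_pos)).add
    (hCy 1 one_pos)
  simp only [add_zero] at hsum
  refine tendsto_of_tendsto_of_tendsto_of_le_of_le' tendsto_const_nhds hsum
    (Eventually.of_forall fun T => zero_le) ?_
  filter_upwards [eventually_ge_atTop T₀] with T hT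
  refine le_trans ?_ ((measure_union_le _ _).trans (add_le_add_left ((measure_union_le _ _).trans
    (add_le_add_left (measure_union_le _ _) _)) _))
  -- The event of a deviation of at least ε lies, up to a null set, in the union of the four bad
  -- events for variances and fourth moments. An almost-everywhere inclusion is needed because
  -- independence, centring and the pushforward identity hold only almost surely.
  refine measure_mono_ae ?_
  filter_upwards [hB1.indep T, hB1.centered T, TFT.condLaw_bootVec P hV hxs hys l T]
    with ω hind hcen hlaw hω
  by_contra hgood
  obtain ⟨⟨⟨hvx, hvy⟩, h4x⟩, h4y⟩ := not_or.mp hgood |>.imp_left fun h =>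
    not_or.mp h |>.imp_left fun h => not_or.mp h
  replace hvx := not_exists_not.mp hvx
  replace hvy := not_exists_not.mp hvy
  rw [Set.mem_ofPred_eq, not_lt] at h4x h4y
  refine absurd (hT₀ T hT _ ⟨?_, hind, fun s => (hcen s).2, ?_, ?_⟩) (not_lt.mpr ?_)
  · unfold TFT.condLaw
    infer_instance
  · rintro (k | k)
    · exact hvx k
    · exact hvy k
  · rintro (k | k)
    · refine ((le_iSup _ k).trans h4x).trans ?_
      exact_mod_cast le_max_left (Cx + 1) (Cy + 1)
    · refine ((le_iSup _ k).trans h4y).trans ?_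
      exact_mod_cast le_max_right (Cx + 1) (Cy + 1)
  · rw [← hlaw]
    exact hω
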